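/- Let $d\ge 4$ be a prime power. A pure state is a unit vector of $\mathbb C^d$; two orthonormal bases $\{a_i\},\{b_j\}$ are mutually unbiased if $|\langle a_i|b_j\rangle|^2=1/d$ for all $i,j$. An ontological model consists of a measure space $(\Lambda,\mathrm d\lambda)$, a probability density $\mu_\psi\ge 0$ on $\Lambda$ for every pure state $\psi$, and for every projective measurement $M$ response functions $\xi_M(g|\lambda)\ge 0$ with $\sum_g\xi_M(g|\lambda)=1$; it predicts the probabilities $P(g|\psi)=\int_\Lambda \xi_M(g|\lambda)\mu_\psi(\lambda)\,\mathrm d\lambda$ (which need not be the quantum ones). Put $\omega_C(p,q)=1-\tfrac12\int|p-q|\,\mathrm d\lambda$ and $\omega_Q(\psi,\phi)=1-\sqrt{1-|\langle\psi|\phi\rangle|^2}$. (a) There exist $d+1$ pairwise mutually unbiased bases of $\mathbb C^d$. Given any such family, let $c$ be an element of one basis and let $\{e^\alpha_i\}_{i=1}^d$, $\alpha=1,\dots,d$, be the remaining bases. Then for all $\alpha<\beta$ and all $i,j$ there are orthonormal vectors $f_1,f_2,f_3$ whose span contains $e^\alpha_i,e^\beta_j,c$ and which satisfy $\langle f_1|e^\alpha_i\rangle=\langle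 f_2|e^\beta_j\rangle=\langle f_3|c\rangle=0$. (b) Fix such bases, such a $c$, and for every $\alpha<\beta$, $i,j$ such a triple $(f_1,f_2,f_3)$; let $M$ be the corresponding projective measurement with outcomes $f_1,f_2,f_3,f_4$, where $f_4$ is the projector onto the orthogonal complement of $\mathrm{span}(f_1,f_2,f_3)$. For the projective measurements onto the $d+1$ bases and the measurements $M$, let $R[g|\psi]$ be the observed relative frequency of outcome $g$ when the element $\psi$ of one of the $d+1$ bases is prepared, and assume that outcome $f_4$ of $M$ is never observed on the three states of its triple: $R[f_4|e^\alpha_i]=R[f_4|e^\beta_j]=R[f_4|c]=0$. Define $$\epsilon(c,e^\alpha_i,e^\beta_j)=\tfrac13\bigl(R[f_1|e^\alpha_i]+R[f_2|e^\beta_j]+R[f_3|c]\bigr),\qquad \epsilon(e^\alpha_i,e^\alpha_j)=\tfrac12\bigl(R[e^\alpha_j|e^\alpha_i]+R[e^\alpha_i|e^\alpha_j]\bigr),$$ $$\epsilon_1=\frac{\sum_{\alpha<\beta}\sum_{i,j}\epsilon(c,e^\alpha_i,e^\beta_j)}{d^3(d-1)/2},\qquad \epsilon_2=\frac{\sum_{\alpha}\sum_{i<j}\epsilon(e^\alpha_i,e^\alpha_j)}{d^2(d-1)/2}.$$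 Suppose that an ontological model satisfies $P(g|\psi)=R[g|\psi]$ for all these preparations, measurements and outcomes, and that, for some real constant $k$, $\omega_C(\mu_\psi,\mu_\phi)\ge k\,\omega_Q(\psi,\phi)$ for all pure states $\psi,\phi$. Then $$k\,d^2\Bigl(1-\sqrt{1-\tfrac1d}\Bigr)\le 1+3\sum_{\alpha<\beta}\sum_{i,j}\epsilon(c,e^\alpha_i,e^\beta_j)+2\sum_{\alpha}\sum_{i<j}\epsilon(e^\alpha_i,e^\alpha_j),$$ and consequently $$k<\frac2d+d^2(3d\,\epsilon_1+2\epsilon_2).$$ In particular sufficiently small average noise forces $k<1$: the number $\frac{2}{d-1}\bigl(1-\sqrt{1-1/d}-\frac1{d^2}\bigr)$ is positive, and if $3d\,\epsilon_1+2\epsilon_2<\frac{2}{d-1}\bigl(1-\sqrt{1-1/d}-\frac1{d^2}\bigr)$, then $k<1$. -/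

import Mathlib

open scoped InnerProductSpace
open MeasureTheory

noncomputable section

namespace OntModel

/-- The Hilbert space `ℂ^d`. -/
abbrev Hilb (d : ℕ) : Type := EuclideanSpace ℂ (Fin d)

/-- Pure states, represented by unit vectors. -/
abbrev PureState (d : ℕ) : Type := {ψ : Hilb d // ‖ψ‖ = 1}

/-- A projective measurement with `n` outcomes: the ranges of the projectors are pairwise
orthogonal and together span the space. -/
structure ProjMeas (d n : ℕ) where
  range : Fin n → Submodule ℂ (Hilb d)
  orthogonal : Pairwise fun g h => range g ⟂ range h
  complete : ⨆ g, range g = ⊤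

/-- An ontological model for a `d`-dimensional quantum system, with ontic state space `Λ`
carrying the reference measure `ν` (written `dλ`).  Every pure state gets an epistemic state
`μ ψ`, a probability density on `Λ`, and every projective measurement gets a response function
`ξ M`.  Agreement with the quantum (Born) probabilities is not required. -/
structure OntologicalModel (d : ℕ) (Λ : Type*) [MeasurableSpace Λ] (ν : Measure Λ) where
  μ : PureState d → Λ → ℝ
  μ_nonneg : ∀ ψ l, 0 ≤ μ ψ l
  μ_integrable : ∀ ψ, Integrable (μ ψ) ν
  μ_integral : ∀ ψ, ∫ l, μ ψ l ∂ν = 1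
  ξ : ∀ {n : ℕ}, ProjMeas d n → Fin n → Λ → ℝ
  ξ_measurable : ∀ {n : ℕ} (M : ProjMeas d n) (g : Fin n), Measurable (ξ M g)
  ξ_nonneg : ∀ {n : ℕ} (M : ProjMeas d n) (g : Fin n) (l : Λ), 0 ≤ ξ M g l
  ξ_sum : ∀ {n : ℕ} (M : ProjMeas d n) (l : Λ), ∑ g, ξ M g l = 1

/-- The probability `P(g|ψ)` that the model predicts for outcome `g` of `M` on preparation `ψ`. -/
def OntologicalModel.prob {d : ℕ} {Λ : Type*} [MeasurableSpace Λ] {ν : Measure Λ}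
    (m : OntologicalModel d Λ ν) {n : ℕ} (M : ProjMeas d n) (g : Fin n) (ψ : PureState d) : ℝ :=
  ∫ l, m.ξ M g l * m.μ ψ l ∂ν

/-- Classical trace distance of two densities. -/
def deltaC {Λ : Type*} [MeasurableSpace Λ] (ν : Measure Λ) (p q : Λ → ℝ) : ℝ :=
  (1 / 2) * ∫ l, |p l - q l| ∂ν

/-- Classical overlap of two densities. -/
def omegaC {Λ : Type*} [MeasurableSpace Λ] (ν : Measure Λ) (p q : Λ → ℝ) : ℝ :=
  1 - deltaC ν p q

/-- Quantum trace distance of two pure states. -/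
def deltaQ {d : ℕ} (ψ φ : PureState d) : ℝ :=
  Real.sqrt (1 - ‖⟪(ψ : Hilb d), (φ : Hilb d)⟫_ℂ‖ ^ 2)

/-- Quantum overlap of two pure states. -/
def omegaQ {d : ℕ} (ψ φ : PureState d) : ℝ :=
  1 - deltaQ ψ φ

/-- The bases of the family are pairwise mutually unbiased. -/
def MutuallyUnbiased {d : ℕ} {ι : Type*} (B : ι → OrthonormalBasis (Fin d) ℂ (Hilb d)) : Prop :=
  ∀ a b, a ≠ b → ∀ i j, ‖⟪B a i, B b j⟫_ℂ‖ ^ 2 = 1 / (d : ℝ)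

/-- The `i`-th vector of an orthonormal basis, as a pure state. -/
def basisState {d : ℕ} (b : OrthonormalBasis (Fin d) ℂ (Hilb d)) (i : Fin d) : PureState d :=
  ⟨b i, b.orthonormal.1 i⟩

/-- The projective measurement onto an orthonormal basis. -/
def basisMeas {d : ℕ} (b : OrthonormalBasis (Fin d) ℂ (Hilb d)) : ProjMeas d d where
  range i := ℂ ∙ (b i)
  orthogonal := by
    intro i j hij
    rw [Submodule.isOrtho_span]
    rintro u hu v hv
    rw [Set.mem_singleton_iff] at hu hv
    subst hu hv
    exact b.orthonormal.2 hij
  complete := by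
    rw [← Submodule.span_range_eq_iSup, ← OrthonormalBasis.coe_toBasis]
    exact b.toBasis.span_eq

/-- Orthonormal triples of vectors. -/
abbrev OrthoTriple (d : ℕ) : Type := {f : Fin 3 → Hilb d // Orthonormal ℂ f}

/-- The four-outcome projective measurement given by an orthonormal triple: outcomes `0, 1, 2` are
the vectors of the triple, outcome `3` is the projector onto the orthogonal subspace. -/
def tripleMeas {d : ℕ} (f : OrthoTriple d) : ProjMeas d 4 where
  range := Fin.snoc (α := fun _ => Submodule ℂ (Hilb d)) (fun i : Fin 3 => ℂ ∙ (f.1 i))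
    (Submodule.span ℂ (Set.range f.1))ᗮ
  orthogonal := by
    have key : ∀ i : Fin 3, (ℂ ∙ (f.1 i)) ≤ Submodule.span ℂ (Set.range f.1) := fun i =>
      Submodule.span_mono (Set.singleton_subset_iff.2 (Set.mem_range_self i))
    intro i j hij
    induction i using Fin.lastCases with
    | last =>
      induction j using Fin.lastCases with
      | last => exact absurd rfl hij
      | cast j =>
        simp only [Fin.snoc_last, Fin.snoc_castSucc]
        exact ((Submodule.isOrtho_orthogonal_right _).mono_left (key j)).symm
    | cast i =>
      induction j using Fin.lastCases with
      | last =>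
        simp only [Fin.snoc_last, Fin.snoc_castSucc]
        exact (Submodule.isOrtho_orthogonal_right _).mono_left (key i)
      | cast j =>
        simp only [Fin.snoc_castSucc]
        rw [Submodule.isOrtho_span]
        rintro u hu v hv
        rw [Set.mem_singleton_iff] at hu hv
        subst hu hv
        exact f.2.2 (fun h => hij (by rw [h]))
  complete := by
    rw [eq_top_iff, ← Submodule.sup_orthogonal_of_hasOrthogonalProjection
      (K := Submodule.span ℂ (Set.range f.1))]
    refine sup_le ?_ ?_
    · rw [Submodule.span_range_eq_iSup]
      refine iSup_le fun i => ?_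
      refine le_trans (le_of_eq ?_) (le_iSup _ (Fin.castSucc i))
      simp only [Fin.snoc_castSucc]
    · refine le_trans (le_of_eq ?_) (le_iSup _ (Fin.last 3))
      simp only [Fin.snoc_last]

/-- The orthonormal triple `f` is aligned with the subspace spanned by `a, b, c` (contains it, hence
equals it as soon as `a, b, c` are linearly independent), and `f 0 ⟂ a`, `f 1 ⟂ b`, `f 2 ⟂ c`. -/
structure PPTriple {d : ℕ} (f : OrthoTriple d) (a b c : PureState d) : Prop where
  aligned : ∀ ψ ∈ ({a, b, c} : Set (PureState d)), (ψ : Hilb d) ∈ Submodule.span ℂ (Set.range f.1)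
  orth_a : ⟪f.1 0, (a : Hilb d)⟫_ℂ = 0
  orth_b : ⟪f.1 1, (b : Hilb d)⟫_ℂ = 0
  orth_c : ⟪f.1 2, (c : Hilb d)⟫_ℂ = 0

/-- The setting of the experiment: `d + 1` mutually unbiased bases, a state `c` that is the element
number `i₀` of the basis number `0`, and for every pair of states `e^α_i`, `e^β_j` with `α < β` from
the other `d` bases a measurement with outcomes `f 0, f 1, f 2` and the orthogonal subspace, such
that `f 0 ⟂ e^α_i`, `f 1 ⟂ e^β_j`, `f 2 ⟂ c`.  (The values `f α i β j` with `β ≤ α` are unused.) -/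
structure Setup (d : ℕ) where
  B : Fin (d + 1) → OrthonormalBasis (Fin d) ℂ (Hilb d)
  mub : MutuallyUnbiased B
  i₀ : Fin d
  f : Fin d → Fin d → Fin d → Fin d → OrthoTriple d
  pp : ∀ α i β j, α < β →
    PPTriple (f α i β j) (basisState (B α.succ) i) (basisState (B β.succ) j) (basisState (B 0) i₀)

namespace Setup

variable {d : ℕ} (E : Setup d)

/-- The state `c`. -/
def c : PureState d := basisState (E.B 0) E.i₀

/-- The states `e^α_i`. -/
def e (α i : Fin d) : PureState d := basisState (E.B α.succ) i

end Setup

/-- Observed relative frequencies: `R M g ψ` is the relative frequency of outcome `g` when `M` is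
measured on the preparation `ψ`. -/
abbrev Frequencies (d : ℕ) : Type := ∀ {n : ℕ}, ProjMeas d n → Fin n → PureState d → ℝ

/-- The model predicts the observed frequencies, for all preparations (the elements of the `d + 1`
bases) and all measurements (onto a basis, or associated with a triple) of the experiment. -/
structure Predicts {d : ℕ} {Λ : Type*} [MeasurableSpace Λ] {ν : Measure Λ}
    (m : OntologicalModel d Λ ν) (E : Setup d) (R : Frequencies d) : Prop where
  basis : ∀ (a : Fin (d + 1)) (g : Fin d) (b : Fin (d + 1)) (l : Fin d),
    m.prob (basisMeas (E.B a)) g (basisState (E.B b) l) =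
      R (basisMeas (E.B a)) g (basisState (E.B b) l)
  triple : ∀ α i β j, α < β → ∀ (g : Fin 4) (b : Fin (d + 1)) (l : Fin d),
    m.prob (tripleMeas (E.f α i β j)) g (basisState (E.B b) l) =
      R (tripleMeas (E.f α i β j)) g (basisState (E.B b) l)

/-- The fourth outcome of the measurement associated with a triple is never observed on the three
states of that triple. -/
def NoFourthOutcome {d : ℕ} (E : Setup d) (R : Frequencies d) : Prop :=
  ∀ α i β j, α < β → ∀ ψ ∈ ({E.e α i, E.e β j, E.c} : Set (PureState d)),
    R (tripleMeas (E.f α i β j)) 3 ψ = 0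

/-- The noise `ε(c, e^α_i, e^β_j)`. -/
def epsTriple {d : ℕ} (E : Setup d) (R : Frequencies d) (α i β j : Fin d) : ℝ :=
  (1 / 3) * (R (tripleMeas (E.f α i β j)) 0 (E.e α i) + R (tripleMeas (E.f α i β j)) 1 (E.e β j) +
    R (tripleMeas (E.f α i β j)) 2 E.c)

/-- The noise `ε(e^α_i, e^α_j)`. -/
def epsPair {d : ℕ} (E : Setup d) (R : Frequencies d) (α i j : Fin d) : ℝ :=
  (1 / 2) * (R (basisMeas (E.B α.succ)) j (E.e α i) + R (basisMeas (E.B α.succ)) i (E.e α j))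

/-- Sum of `ε(c, e^α_i, e^β_j)` over `α < β` and all `i, j`. -/
def sumTriple {d : ℕ} (E : Setup d) (R : Frequencies d) : ℝ :=
  ∑ α : Fin d, ∑ β ∈ Finset.Ioi α, ∑ i : Fin d, ∑ j : Fin d, epsTriple E R α i β j

/-- Sum of `ε(e^α_i, e^α_j)` over all `α` and `i < j`. -/
def sumPair {d : ℕ} (E : Setup d) (R : Frequencies d) : ℝ :=
  ∑ α : Fin d, ∑ i : Fin d, ∑ j ∈ Finset.Ioi i, epsPair E R α i j

/-- The average noise `ε₁`. -/
def eps1 {d : ℕ} (E : Setup d) (R : Frequencies d) : ℝ :=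
  sumTriple E R / ((d : ℝ) ^ 3 * ((d : ℝ) - 1) / 2)

/-- The average noise `ε₂`. -/
def eps2 {d : ℕ} (E : Setup d) (R : Frequencies d) : ℝ :=
  sumPair E R / ((d : ℝ) ^ 2 * ((d : ℝ) - 1) / 2)

end OntModel

end

/-! The bounds come from squeezing the sum of the `d²` classical overlaps `∫ min (μ_e) (μ_c)` over
all states `e = e^α_i`. By unbiasedness every quantum overlap with `c` equals `1 - √(1 - 1/d)`, so
the sum is at least `k d²` times that value. Without noise, almost every ontic state in the support
of `μ_c` would lie in the support of at most one `μ_e`, so the sum would be at most `∫ μ_c = 1`.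
With noise, `sum_min_le` bounds the excess pointwise: two states of one basis are charged to the
response functions of that basis, two states of different bases to their threefold minimum with `c`.
The integral of such a minimum is at most the probability of the excluded outcomes of the triple
measurement (`integral_min_min_le`), because its response functions sum to one.

Existence of the triples: three states with pairwise transition probability `x ≤ 1/4` have the Gram
matrix of an explicit configuration in which each vector omits one member of an orthonormal triple;
an isometry carries that configuration to them (`exists_ppTriple`). Existence of the bases: over the
field with `d` elements, quadratic phases times additive characters give `d` bases, unbiased by a
Gauss sum computation. To cover characteristic 2, where `x²/2` is meaningless, the phases come from
the divisibility of the circle group (`exists_polarization`). -/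

noncomputable section

namespace OntModel

/-! ### Pointwise inequalities -/

/-- A sum of reals in `[0, c]` exceeds `c` by at most the sum of the pairwise minima. -/
theorem sum_le_add_sum_min {n : ℕ} (Y : Fin n → ℝ) (hY : ∀ a, 0 ≤ Y a) (c : ℝ) (hc : 0 ≤ c)
    (hYc : ∀ a, Y a ≤ c) :
    ∑ a, Y a ≤ c + ∑ a, ∑ b ∈ Finset.Ioi a, min (Y a) (Y b) := by
  induction n generalizing c with
  | zero => simpa using hc
  | succ n ih =>
    rw [Fin.sum_univ_succ, Fin.sum_univ_succ, Fin.sum_Ioi_zero]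
    simp only [Fin.sum_Ioi_succ]
    rcases n.eq_zero_or_pos with rfl | hn
    · simpa using hYc 0
    · have : Nonempty (Fin n) := ⟨⟨0, hn⟩⟩
      obtain ⟨m, hm⟩ := Finite.exists_max fun a : Fin n => Y a.succ
      -- The tail is bounded by its own maximum instead of `c`; that maximum then merges with `Y 0`
      -- through `min + max`.
      have h1 := ih (fun a => Y a.succ) (fun a => hY _) (Y m.succ) (hY _) hm
      have h2 : min (Y 0) (Y m.succ) ≤ ∑ b : Fin n, min (Y 0) (Y b.succ) :=
        Finset.single_le_sum (f := fun b : Fin n => min (Y 0) (Y b.succ))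
          (fun b _ => le_min (hY _) (hY _)) (Finset.mem_univ m)
      have h3 := min_add_max (Y 0) (Y m.succ)
      have h4 : max (Y 0) (Y m.succ) ≤ c := max_le (hYc _) (hYc _)
      linarith

/-- Pointwise form of the overlap inequality: within a family, the excess is controlled by
response functions `ξ α`, between different families by threefold minima. -/
theorem sum_min_le {n d : ℕ} [NeZero d] (x ξ : Fin n → Fin d → ℝ) (hx : ∀ α i, 0 ≤ x α i)
    (hξ : ∀ α i, 0 ≤ ξ α i) (hξ1 : ∀ α, ∑ i, ξ α i = 1) (c : ℝ) (hc : 0 ≤ c) :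
    ∑ α, ∑ i, min (x α i) c ≤ c +
      ∑ α, ∑ β ∈ Finset.Ioi α, ∑ i, ∑ j, min (min (x α i) (x β j)) c +
      ∑ α, ∑ i, ∑ j ∈ Finset.Ioi i, (ξ α j * x α i + ξ α i * x α j) := by
  have hy : ∀ α i, 0 ≤ min (x α i) c := fun α i => le_min (hx α i) hc
  choose m hm using fun α => Finite.exists_max fun i => min (x α i) c
  have h1 := sum_le_add_sum_min (fun α => min (x α (m α)) c) (fun α => hy _ _) c hc
    (fun α => min_le_right _ _)
  have h2 : ∀ α, ∑ i, min (x α i) c ≤ min (x α (m α)) c +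
      ∑ i, ∑ j ∈ Finset.Ioi i, (ξ α j * x α i + ξ α i * x α j) := by
    intro α
    rw [Finset.sum_sum_Ioi_add_eq_sum_sum_off_diag (fun j i => ξ α j * x α i)]
    -- Split each minimum with weights `ξ α i` and `1 - ξ α i`: the first parts average to at most
    -- the maximum, the second parts are the off-diagonal response terms.
    have e1 : ∀ i, ∑ j ∈ {i}ᶜ, ξ α j * x α i = (1 - ξ α i) * x α i := by
      intro i
      rw [← Finset.sum_mul, ← hξ1 α, ← Finset.sum_add_sum_compl {i} (ξ α)]
      simp
    have e2 : ∑ i, ξ α i * min (x α i) c ≤ min (x α (m α)) c := by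
      calc ∑ i, ξ α i * min (x α i) c ≤ ∑ i, ξ α i * min (x α (m α)) c :=
            Finset.sum_le_sum fun i _ => mul_le_mul_of_nonneg_left (hm α i) (hξ α i)
        _ = _ := by rw [← Finset.sum_mul, hξ1, one_mul]
    have e3 : ∀ i, min (x α i) c ≤ ξ α i * min (x α i) c + (1 - ξ α i) * x α i := by
      intro i
      have : ξ α i ≤ 1 := by
        rw [← hξ1 α]
        exact Finset.single_le_sum (fun j _ => hξ α j) (Finset.mem_univ i)
      have := mul_le_mul_of_nonneg_left (min_le_left (x α i) c) (sub_nonneg.2 this)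
      linarith
    calc ∑ i, min (x α i) c ≤ ∑ i, (ξ α i * min (x α i) c + (1 - ξ α i) * x α i) :=
          Finset.sum_le_sum fun i _ => e3 i
      _ ≤ _ := by
        rw [Finset.sum_add_distrib]
        simp only [e1]
        linarith
  have h3 : ∀ α β, min (min (x α (m α)) c) (min (x β (m β)) c) ≤
      ∑ i, ∑ j, min (min (x α i) (x β j)) c := by
    intro α β
    have hnn : ∀ i j, 0 ≤ min (min (x α i) (x β j)) c := fun i j =>
      le_min (le_min (hx _ _) (hx _ _)) hc
    refine le_trans (le_of_eq (inf_inf_distrib_right _ _ _).symm) ?_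
    refine (Finset.single_le_sum (f := fun j => min (min (x α (m α)) (x β j)) c)
      (fun j _ => hnn _ j) (Finset.mem_univ (m β))).trans ?_
    exact Finset.single_le_sum (f := fun i => ∑ j, min (min (x α i) (x β j)) c)
      (fun i _ => Finset.sum_nonneg fun j _ => hnn i j) (Finset.mem_univ (m α))
  calc ∑ α, ∑ i, min (x α i) c ≤ ∑ α, (min (x α (m α)) c +
      ∑ i, ∑ j ∈ Finset.Ioi i, (ξ α j * x α i + ξ α i * x α j)) :=
        Finset.sum_le_sum fun α _ => h2 α
    _ ≤ _ := by
      rw [Finset.sum_add_distrib]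
      gcongr
      refine h1.trans ?_
      gcongr with α _ β _
      exact h3 α β

/-! ### Overlap integrals in an ontological model -/

namespace OntologicalModel

variable {d : ℕ} {Λ : Type*} [MeasurableSpace Λ] {ν : Measure Λ} (m : OntologicalModel d Λ ν)

theorem ξ_le_one {n : ℕ} (M : ProjMeas d n) (g : Fin n) (l : Λ) : m.ξ M g l ≤ 1 := by
  rw [← m.ξ_sum M l]
  exact Finset.single_le_sum (fun j _ => m.ξ_nonneg M j l) (Finset.mem_univ g)

theorem integrable_ξ_mul {n : ℕ} (M : ProjMeas d n) (g : Fin n) {p : Λ → ℝ}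
    (hp : Integrable p ν) : Integrable (fun l => m.ξ M g l * p l) ν := by
  refine hp.bdd_mul (c := 1) (m.ξ_measurable M g).aestronglyMeasurable ?_
  refine Filter.Eventually.of_forall fun l => ?_
  rw [Real.norm_eq_abs, abs_of_nonneg (m.ξ_nonneg M g l)]
  exact m.ξ_le_one M g l

theorem prob_nonneg {n : ℕ} (M : ProjMeas d n) (g : Fin n) (ψ : PureState d) :
    0 ≤ m.prob M g ψ :=
  integral_nonneg fun l => mul_nonneg (m.ξ_nonneg M g l) (m.μ_nonneg ψ l)

theorem integrable_min (ψ φ : PureState d) : Integrable (fun l => min (m.μ ψ l) (m.μ φ l)) ν :=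
  (m.μ_integrable ψ).inf (m.μ_integrable φ)

theorem omegaC_eq (ψ φ : PureState d) :
    omegaC ν (m.μ ψ) (m.μ φ) = ∫ l, min (m.μ ψ l) (m.μ φ l) ∂ν := by
  have h : ∀ l, min (m.μ ψ l) (m.μ φ l) =
      (1 / 2) * ((m.μ ψ l + m.μ φ l) - |m.μ ψ l - m.μ φ l|) := by
    intro l
    rcases le_total (m.μ ψ l) (m.μ φ l) with h | h
    · rw [min_eq_left h, abs_of_nonpos (by linarith)]
      ring
    · rw [min_eq_right h, abs_of_nonneg (by linarith)]
      ring
  have hs : Integrable (fun l => m.μ ψ l + m.μ φ l) ν := (m.μ_integrable ψ).add (m.μ_integrable φ)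
  have ha : Integrable (fun l => |m.μ ψ l - m.μ φ l|) ν :=
    ((m.μ_integrable ψ).sub (m.μ_integrable φ)).abs
  simp only [h]
  rw [integral_const_mul, integral_sub hs ha,
    integral_add (m.μ_integrable ψ) (m.μ_integrable φ), m.μ_integral, m.μ_integral, omegaC, deltaC]
  ring

theorem integrable_min_min (a b c : PureState d) :
    Integrable (fun l => min (min (m.μ a l) (m.μ b l)) (m.μ c l)) ν :=
  ((m.μ_integrable a).inf (m.μ_integrable b)).inf (m.μ_integrable c)

/-- The threefold overlap is at most the total probability of the outcomes of any measurement with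
four outcomes, each evaluated on one of the three states. -/
theorem integral_min_min_le (M : ProjMeas d 4) (a b c : PureState d) :
    ∫ l, min (min (m.μ a l) (m.μ b l)) (m.μ c l) ∂ν ≤
      m.prob M 0 a + m.prob M 1 b + m.prob M 2 c + m.prob M 3 c := by
  have hi := fun g ψ => m.integrable_ξ_mul M g (m.μ_integrable ψ)
  have h2 : Integrable (fun l => m.ξ M 0 l * m.μ a l + m.ξ M 1 l * m.μ b l) ν :=
    (hi 0 a).add (hi 1 b)
  have h3 : Integrable (fun l => m.ξ M 0 l * m.μ a l + m.ξ M 1 l * m.μ b l +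
    m.ξ M 2 l * m.μ c l) ν := h2.add (hi 2 c)
  unfold prob
  rw [← integral_add (hi 0 a) (hi 1 b), ← integral_add h2 (hi 2 c), ← integral_add h3 (hi 3 c)]
  refine integral_mono (m.integrable_min_min a b c) (h3.add (hi 3 c)) fun l => ?_
  have hs := m.ξ_sum M l
  rw [Fin.sum_univ_four] at hs
  set t := min (min (m.μ a l) (m.μ b l)) (m.μ c l)
  have ha : t ≤ m.μ a l := (min_le_left _ _).trans (min_le_left _ _)
  have hb : t ≤ m.μ b l := (min_le_left _ _).trans (min_le_right _ _)
  have hc : t ≤ m.μ c l := min_le_right _ _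
  -- The minimum is distributed over the four outcomes, and in each share it is replaced by the
  -- density of the state charged with that outcome.
  calc t = m.ξ M 0 l * t + m.ξ M 1 l * t + m.ξ M 2 l * t + m.ξ M 3 l * t := by
        rw [← add_mul, ← add_mul, ← add_mul, hs, one_mul]
    _ ≤ m.ξ M 0 l * m.μ a l + m.ξ M 1 l * m.μ b l + m.ξ M 2 l * m.μ c l + m.ξ M 3 l * m.μ c l := by
        have := m.ξ_nonneg M
        gcongr <;> apply this

end OntologicalModel

/-! ### Overlaps bounded by the observed noise -/

section Bounds

variable {d : ℕ} {Λ : Type*} [MeasurableSpace Λ] {ν : Measure Λ} {m : OntologicalModel d Λ ν}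
  {E : Setup d} {R : Frequencies d}

theorem integral_min_min_le_epsTriple (hP : Predicts m E R) (hN : NoFourthOutcome E R)
    {α β : Fin d} (h : α < β) (i j : Fin d) :
    ∫ l, min (min (m.μ (E.e α i) l) (m.μ (E.e β j) l)) (m.μ E.c l) ∂ν ≤
      3 * epsTriple E R α i β j := by
  refine (m.integral_min_min_le (tripleMeas (E.f α i β j)) _ _ _).trans (le_of_eq ?_)
  have h0 := hP.triple α i β j h 0 α.succ i
  have h1 := hP.triple α i β j h 1 β.succ j
  have h2 := hP.triple α i β j h 2 0 E.i₀
  have h3 := hP.triple α i β j h 3 0 E.i₀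
  have h4 := hN α i β j h E.c (by simp)
  unfold epsTriple
  unfold Setup.e Setup.c at *
  dsimp only at h4 ⊢
  rw [h0, h1, h2, h3, h4]
  ring

theorem prob_add_prob_eq_epsPair (hP : Predicts m E R) (α i j : Fin d) :
    m.prob (basisMeas (E.B α.succ)) j (E.e α i) + m.prob (basisMeas (E.B α.succ)) i (E.e α j) =
      2 * epsPair E R α i j := by
  have h1 := hP.basis α.succ j α.succ i
  have h2 := hP.basis α.succ i α.succ j
  unfold epsPair
  unfold Setup.e at *
  rw [h1, h2]
  ring

theorem sumTriple_nonneg (hP : Predicts m E R) : 0 ≤ sumTriple E R := by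
  refine Finset.sum_nonneg fun α _ => Finset.sum_nonneg fun β hβ => Finset.sum_nonneg fun i _ =>
    Finset.sum_nonneg fun j _ => ?_
  have h := hP.triple α i β j (Finset.mem_Ioi.1 hβ)
  have h0 := h 0 α.succ i
  have h1 := h 1 β.succ j
  have h2 := h 2 0 E.i₀
  unfold epsTriple Setup.e Setup.c
  dsimp only
  rw [← h0, ← h1, ← h2]
  have := m.prob_nonneg (tripleMeas (E.f α i β j))
  have hx := this 0 (basisState (E.B α.succ) i)
  have hy := this 1 (basisState (E.B β.succ) j)
  have hz := this 2 (basisState (E.B 0) E.i₀)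
  positivity

theorem sumPair_nonneg (hP : Predicts m E R) : 0 ≤ sumPair E R := by
  refine Finset.sum_nonneg fun α _ => Finset.sum_nonneg fun i _ => Finset.sum_nonneg fun j _ => ?_
  have h := prob_add_prob_eq_epsPair hP α i j
  have h1 := m.prob_nonneg (basisMeas (E.B α.succ)) j (E.e α i)
  have h2 := m.prob_nonneg (basisMeas (E.B α.succ)) i (E.e α j)
  linarith

theorem omegaQ_e_c (α i : Fin d) : omegaQ (E.e α i) E.c = 1 - Real.sqrt (1 - 1 / (d : ℝ)) := by
  unfold omegaQ deltaQ
  rw [← E.mub α.succ 0 (Fin.succ_ne_zero α) i E.i₀]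
  rfl

/-- This integrates `sum_min_le` with the densities of the `e^α_i` as `x`, the density of `c` as `c`
(total mass 1) and the responses of the basis measurements as `ξ`. -/
theorem sum_omegaC_le [NeZero d] (hP : Predicts m E R) (hN : NoFourthOutcome E R) :
    ∑ α, ∑ i, omegaC ν (m.μ (E.e α i)) (m.μ E.c) ≤
      1 + 3 * sumTriple E R + 2 * sumPair E R := by
  simp only [m.omegaC_eq]
  have hi := fun (α g : Fin d) ψ =>
    m.integrable_ξ_mul (basisMeas (E.B α.succ)) g (m.μ_integrable ψ)
  have I1 : Integrable (fun l => ∑ α, ∑ β ∈ Finset.Ioi α, ∑ i, ∑ j,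
      min (min (m.μ (E.e α i) l) (m.μ (E.e β j) l)) (m.μ E.c l)) ν :=
    integrable_finsetSum _ fun α _ => integrable_finsetSum _ fun β _ =>
      integrable_finsetSum _ fun i _ => integrable_finsetSum _ fun j _ =>
        m.integrable_min_min _ _ _
  have I2 : Integrable (fun l => ∑ α, ∑ i, ∑ j ∈ Finset.Ioi i,
      (m.ξ (basisMeas (E.B α.succ)) j l * m.μ (E.e α i) l +
        m.ξ (basisMeas (E.B α.succ)) i l * m.μ (E.e α j) l)) ν :=
    integrable_finsetSum _ fun α _ => integrable_finsetSum _ fun i _ =>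
      integrable_finsetSum _ fun j _ => (hi _ _ _).add (hi _ _ _)
  calc ∑ α, ∑ i, ∫ l, min (m.μ (E.e α i) l) (m.μ E.c l) ∂ν
      = ∫ l, ∑ α, ∑ i, min (m.μ (E.e α i) l) (m.μ E.c l) ∂ν := by
        rw [integral_finsetSum _ fun α _ => integrable_finsetSum _ fun i _ =>
          m.integrable_min _ _]
        refine Finset.sum_congr rfl fun α _ => ?_
        rw [integral_finsetSum _ fun i _ => m.integrable_min _ _]
    _ ≤ ∫ l, (m.μ E.c l + ∑ α, ∑ β ∈ Finset.Ioi α, ∑ i, ∑ j,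
          min (min (m.μ (E.e α i) l) (m.μ (E.e β j) l)) (m.μ E.c l) +
        ∑ α, ∑ i, ∑ j ∈ Finset.Ioi i, (m.ξ (basisMeas (E.B α.succ)) j l * m.μ (E.e α i) l +
          m.ξ (basisMeas (E.B α.succ)) i l * m.μ (E.e α j) l)) ∂ν := by
        refine integral_mono (integrable_finsetSum _ fun α _ => integrable_finsetSum _ fun i _ =>
          m.integrable_min _ _) (((m.μ_integrable _).add I1).add I2) fun l => ?_
        exact sum_min_le (fun α i => m.μ (E.e α i) l) (fun α i => m.ξ (basisMeas (E.B α.succ)) i l)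
          (fun _ _ => m.μ_nonneg _ _) (fun _ _ => m.ξ_nonneg _ _ _) (fun _ => m.ξ_sum _ _) _
          (m.μ_nonneg _ _)
    _ ≤ _ := by
        have I3 := (m.μ_integrable E.c).add I1
        simp only [Pi.add_def] at I3
        rw [integral_add I3 I2, integral_add (m.μ_integrable _) I1,
          m.μ_integral]
        gcongr
        · rw [integral_finsetSum _ fun α _ => integrable_finsetSum _ fun β _ =>
            integrable_finsetSum _ fun i _ => integrable_finsetSum _ fun j _ =>
            m.integrable_min_min _ _ _, sumTriple]
          simp only [Finset.mul_sum]
          refine Finset.sum_le_sum fun α _ => ?_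
          rw [integral_finsetSum _ fun β _ => integrable_finsetSum _ fun i _ =>
            integrable_finsetSum _ fun j _ => m.integrable_min_min _ _ _]
          refine Finset.sum_le_sum fun β hβ => ?_
          rw [integral_finsetSum _ fun i _ => integrable_finsetSum _ fun j _ =>
            m.integrable_min_min _ _ _]
          refine Finset.sum_le_sum fun i _ => ?_
          rw [integral_finsetSum _ fun j _ => m.integrable_min_min _ _ _]
          exact Finset.sum_le_sum fun j _ =>
            integral_min_min_le_epsTriple hP hN (Finset.mem_Ioi.1 hβ) i j
        · have hij : ∀ α i j, Integrable (fun l =>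
              m.ξ (basisMeas (E.B α.succ)) j l * m.μ (E.e α i) l +
                m.ξ (basisMeas (E.B α.succ)) i l * m.μ (E.e α j) l) ν :=
            fun α i j => (hi _ _ _).add (hi _ _ _)
          refine le_of_eq ?_
          rw [integral_finsetSum _ fun α _ => integrable_finsetSum _ fun i _ =>
            integrable_finsetSum _ fun j _ => hij α i j, sumPair]
          simp only [Finset.mul_sum]
          refine Finset.sum_congr rfl fun α _ => ?_
          rw [integral_finsetSum _ fun i _ => integrable_finsetSum _ fun j _ => hij α i j]
          refine Finset.sum_congr rfl fun i _ => ?_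
          rw [integral_finsetSum _ fun j _ => hij α i j]
          refine Finset.sum_congr rfl fun j _ => ?_
          rw [integral_add (hi _ _ _) (hi _ _ _), ← prob_add_prob_eq_epsPair hP]
          rfl

theorem mul_le_of_omegaQ_le [NeZero d] (hP : Predicts m E R) (hN : NoFourthOutcome E R) {k : ℝ}
    (hk : ∀ ψ φ : PureState d, k * omegaQ ψ φ ≤ omegaC ν (m.μ ψ) (m.μ φ)) :
    k * (d : ℝ) ^ 2 * (1 - Real.sqrt (1 - 1 / (d : ℝ))) ≤
      1 + 3 * sumTriple E R + 2 * sumPair E R := by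
  refine le_trans ?_ (sum_omegaC_le hP hN)
  calc k * (d : ℝ) ^ 2 * (1 - Real.sqrt (1 - 1 / (d : ℝ)))
      = ∑ α : Fin d, ∑ i : Fin d, k * omegaQ (E.e α i) E.c := by
        simp only [omegaQ_e_c, Finset.sum_const, Finset.card_univ, Fintype.card_fin, nsmul_eq_mul]
        ring
    _ ≤ _ := Finset.sum_le_sum fun α _ => Finset.sum_le_sum fun i _ => hk _ _

end Bounds

/-! ### From the overlap bound to explicit bounds on `k` -/

theorem one_div_two_mul_lt {d : ℝ} (hd : 1 ≤ d) : 1 / (2 * d) < 1 - Real.sqrt (1 - 1 / d) := by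
  have h0 : 0 < d := by linarith
  have h1 : 1 / d ≤ 1 := by rwa [div_le_one h0]
  have hx : 0 < 1 / d := by positivity
  have : Real.sqrt (1 - 1 / d) < 1 - 1 / d / 2 := by
    rw [Real.sqrt_lt' (by linarith)]
    nlinarith
  have e : 1 / (2 * d) = 1 / d / 2 := by field_simp
  linarith

theorem noise_threshold_pos {d : ℝ} (hd : 4 ≤ d) :
    0 < 2 / (d - 1) * (1 - Real.sqrt (1 - 1 / d) - 1 / d ^ 2) := by
  have h := one_div_two_mul_lt (d := d) (by linarith)
  have h2 : 1 / d ^ 2 ≤ 1 / (2 * d) := by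
    apply one_div_le_one_div_of_le <;> nlinarith
  have : 0 < d - 1 := by linarith
  have : 0 < 1 - Real.sqrt (1 - 1 / d) - 1 / d ^ 2 := by linarith
  positivity

/-- Since `δ > 1/(2d)`, a larger `k` would push the left side above `1 + d³N/2`, which is at least
the right side because `N ≥ 0`. -/
theorem lt_of_mul_le {d k N : ℝ} (hd : 4 ≤ d) (hN : 0 ≤ N)
    (h : k * d ^ 2 * (1 - Real.sqrt (1 - 1 / d)) ≤ 1 + d ^ 2 * (d - 1) / 2 * N) :
    k < 2 / d + d ^ 2 * N := by
  have hδ := one_div_two_mul_lt (d := d) (by linarith)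
  set δ := 1 - Real.sqrt (1 - 1 / d)
  have h0 : 0 < d := by linarith
  have hδ0 : 0 < δ := lt_trans (by positivity) hδ
  by_contra! hk
  have hpos : 0 < 2 / d + d ^ 2 * N := by positivity
  have h1 : (2 / d + d ^ 2 * N) * d ^ 2 * (1 / (2 * d)) < k * d ^ 2 * δ := by
    have : 0 < k := by linarith
    calc (2 / d + d ^ 2 * N) * d ^ 2 * (1 / (2 * d)) < (2 / d + d ^ 2 * N) * d ^ 2 * δ := by
          gcongr
      _ ≤ k * d ^ 2 * δ := by gcongr
  have h2 : (2 / d + d ^ 2 * N) * d ^ 2 * (1 / (2 * d)) = 1 + d ^ 3 / 2 * N := by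
    field_simp
  have h3 : 0 ≤ d ^ 2 / 2 * N := by positivity
  nlinarith

theorem lt_one_of_mul_le {d k N : ℝ} (hd : 4 ≤ d)
    (h : k * d ^ 2 * (1 - Real.sqrt (1 - 1 / d)) ≤ 1 + d ^ 2 * (d - 1) / 2 * N)
    (hlt : N < 2 / (d - 1) * (1 - Real.sqrt (1 - 1 / d) - 1 / d ^ 2)) : k < 1 := by
  have hδ := one_div_two_mul_lt (d := d) (by linarith)
  set δ := 1 - Real.sqrt (1 - 1 / d)
  have h0 : 0 < d := by linarith
  have h1 : 0 < d - 1 := by linarith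
  have hδ0 : 0 < δ := lt_trans (by positivity) hδ
  have h2 : d ^ 2 * (d - 1) / 2 * N < d ^ 2 * (d - 1) / 2 * (2 / (d - 1) * (δ - 1 / d ^ 2)) :=
    mul_lt_mul_of_pos_left hlt (by positivity)
  have h3 : d ^ 2 * (d - 1) / 2 * (2 / (d - 1) * (δ - 1 / d ^ 2)) = d ^ 2 * δ - 1 := by
    field_simp
  have h4 : k * (d ^ 2 * δ) < 1 * (d ^ 2 * δ) := by linarith
  exact lt_of_mul_lt_mul_right h4 (by positivity)

theorem noise_eq_eps {d : ℕ} (hd : 2 ≤ d) (E : Setup d) (R : Frequencies d) :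
    3 * sumTriple E R + 2 * sumPair E R =
      (d : ℝ) ^ 2 * ((d : ℝ) - 1) / 2 * (3 * (d : ℝ) * eps1 E R + 2 * eps2 E R) := by
  have h : (2 : ℝ) ≤ d := by exact_mod_cast hd
  have h1 : (d : ℝ) - 1 ≠ 0 := by linarith
  have h0 : (d : ℝ) ≠ 0 := by linarith
  unfold eps1 eps2
  field_simp

/-! ### Existence of the antidistinguishing triples -/

/-- Two finite families of vectors with the same Gram matrix are related by a linear isometry. -/
theorem exists_linearIsometry_of_inner_eq {V ι : Type*} [NormedAddCommGroup V]
    [InnerProductSpace ℂ V] [FiniteDimensional ℂ V] [Fintype ι] (v w : ι → V)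
    (h : ∀ i j, ⟪v i, v j⟫_ℂ = ⟪w i, w j⟫_ℂ) : ∃ L : V →ₗᵢ[ℂ] V, ∀ i, L (v i) = w i := by
  have hn : ∀ c : ι → ℂ, ‖Fintype.linearCombination ℂ v c‖ = ‖Fintype.linearCombination ℂ w c‖ := by
    intro c
    rw [@norm_eq_sqrt_re_inner ℂ, @norm_eq_sqrt_re_inner ℂ]
    simp only [Fintype.linearCombination_apply, sum_inner, inner_sum, inner_smul_left,
      inner_smul_right, h]
  obtain ⟨g, hg⟩ := (Fintype.linearCombination ℂ v).rangeRestrict.exists_rightInverse_of_surjective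
    (LinearMap.range_rangeRestrict _)
  have hg' : ∀ y, Fintype.linearCombination ℂ v (g y) = y := fun y =>
    congrArg Subtype.val (LinearMap.congr_fun hg y)
  let L₀ : LinearMap.range (Fintype.linearCombination ℂ v) →ₗᵢ[ℂ] V :=
    { toLinearMap := Fintype.linearCombination ℂ w ∘ₗ g
      norm_map' := fun y => by
        rw [LinearMap.comp_apply, ← hn, hg', Submodule.coe_norm] }
  refine ⟨L₀.extend, fun i => ?_⟩
  classical
  have hv : Fintype.linearCombination ℂ v (Pi.single i 1) = v i := by
    simp [Fintype.linearCombination_apply_single]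
  have hw : Fintype.linearCombination ℂ w (Pi.single i 1) = w i := by
    simp [Fintype.linearCombination_apply_single]
  have hmem : v i ∈ LinearMap.range (Fintype.linearCombination ℂ v) := ⟨_, hv⟩
  have h1 := L₀.extend_apply ⟨v i, hmem⟩
  refine h1.trans ?_
  change Fintype.linearCombination ℂ w (g ⟨v i, hmem⟩) = w i
  -- The coefficients chosen by `g` need not be the coordinate vector, but the difference is killed
  -- by the combination map of `v`, hence by that of `w`.
  rw [← hw, ← sub_eq_zero, ← map_sub, ← norm_eq_zero, ← hn, map_sub, hg', hv, sub_self, norm_zero]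

theorem exists_orthoTriple {d : ℕ} (hd : 3 ≤ d) : Nonempty (OrthoTriple d) :=
  ⟨⟨fun i => EuclideanSpace.basisFun (Fin d) ℂ (Fin.castLE hd i),
    (EuclideanSpace.basisFun (Fin d) ℂ).orthonormal.comp _ (Fin.castLE_injective hd)⟩⟩

theorem exists_unit_mul_of_norm_sq {z : ℂ} {x : ℝ} (hz : ‖z‖ ^ 2 = x) :
    ∃ u : ℂ, (starRingEnd ℂ) u * u = 1 ∧ z = u * (Real.sqrt x : ℂ) := by
  rw [← hz, Real.sqrt_sq (norm_nonneg z)]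
  by_cases h : z = 0
  · exact ⟨1, by simp, by simp [h]⟩
  · have hz : (‖z‖ : ℂ) ≠ 0 := by simpa using h
    refine ⟨z / ‖z‖, ?_, by field_simp⟩
    rw [Complex.conj_mul', norm_div]
    simp [h]

/-- Three pure states with pairwise transition probability `x ≤ 1/4` admit an antidistinguishing
triple. -/
theorem exists_ppTriple {d : ℕ} (hd : 3 ≤ d) {x : ℝ} (hx0 : 0 ≤ x) (hx : x ≤ 1 / 4)
    (a b c : PureState d) (hab : ‖⟪(a : Hilb d), (b : Hilb d)⟫_ℂ‖ ^ 2 = x)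
    (hbc : ‖⟪(b : Hilb d), (c : Hilb d)⟫_ℂ‖ ^ 2 = x)
    (hca : ‖⟪(c : Hilb d), (a : Hilb d)⟫_ℂ‖ ^ 2 = x) :
    ∃ f : OrthoTriple d, PPTriple f a b c := by
  -- A real root exists because `x ≤ 1/4`. Weights `√t`, `√(1 - t)` then give unit vectors whose
  -- overlaps have modulus `√x`.
  obtain ⟨t, ht0, ht1, ht⟩ : ∃ t : ℝ, 0 ≤ t ∧ t ≤ 1 ∧ t * (1 - t) = x := by
    have h1 : 0 ≤ 1 - 4 * x := by linarith
    have h2 : Real.sqrt (1 - 4 * x) ≤ 1 := Real.sqrt_le_one.2 (by linarith)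
    have h3 := Real.sqrt_nonneg (1 - 4 * x)
    exact ⟨(1 - Real.sqrt (1 - 4 * x)) / 2, by linarith, by linarith, by
      nlinarith [Real.sq_sqrt h1]⟩
  obtain ⟨p, hp, hp'⟩ := exists_unit_mul_of_norm_sq hab
  obtain ⟨q, hq, hq'⟩ := exists_unit_mul_of_norm_sq hbc
  obtain ⟨u, hu, hu'⟩ := exists_unit_mul_of_norm_sq hca
  rw [← ht, Real.sqrt_mul ht0] at hp' hq' hu'
  push_cast at hp' hq' hu'
  have hr : (Real.sqrt t : ℂ) * Real.sqrt t = t := by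
    rw [← Complex.ofReal_mul, Real.mul_self_sqrt ht0]
  have hs : (Real.sqrt (1 - t) : ℂ) * Real.sqrt (1 - t) = 1 - t := by
    rw [← Complex.ofReal_mul, Real.mul_self_sqrt (by linarith)]
    push_cast
    rfl
  set r : ℂ := (Real.sqrt t : ℂ) with hrdef
  set s : ℂ := (Real.sqrt (1 - t) : ℂ) with hsdef
  have hrc : (starRingEnd ℂ) r = r := Complex.conj_ofReal _
  have hsc : (starRingEnd ℂ) s = s := Complex.conj_ofReal _
  obtain ⟨g, hg⟩ := exists_orthoTriple hd
  have hg' : ∀ i j, ⟪g i, g j⟫_ℂ = if i = j then 1 else 0 := orthonormal_iff_ite.1 hg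
  have hself : ∀ ψ : PureState d, ⟪(ψ : Hilb d), (ψ : Hilb d)⟫_ℂ = 1 := fun ψ => by
    rw [inner_self_eq_norm_sq_to_K, ψ.2]
    simp
  -- Any two model vectors share exactly one `g i`, so each overlap is a single product `r * s`
  -- times a phase that can be prescribed independently.
  obtain ⟨L, hL⟩ := exists_linearIsometry_of_inner_eq
    (v := ![(r * u) • g 1 + s • g 2, s • g 0 + (r * p) • g 2, (r * q) • g 0 + s • g 1])
    (w := ![(a : Hilb d), b, c]) (by
      have hba : ⟪(b : Hilb d), (a : Hilb d)⟫_ℂ = (starRingEnd ℂ) (p * (r * s)) := by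
        rw [← hp', inner_conj_symm]
      have hcb : ⟪(c : Hilb d), (b : Hilb d)⟫_ℂ = (starRingEnd ℂ) (q * (r * s)) := by
        rw [← hq', inner_conj_symm]
      have hac : ⟪(a : Hilb d), (c : Hilb d)⟫_ℂ = (starRingEnd ℂ) (u * (r * s)) := by
        rw [← hu', inner_conj_symm]
      intro i j
      fin_cases i <;> fin_cases j <;>
        simp [hg', hself, -inner_self_eq_norm_sq_to_K,
          hp', hq', hu', hba, hcb, hac, hrc, hsc]
      all_goals first
        | linear_combination r * r * hu + hr + hs
        | linear_combination r * r * hp + hr + hs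
        | linear_combination r * r * hq + hr + hs
        | ring)
  have hLa : r • u • L (g 1) + s • L (g 2) = a := by simpa [mul_smul] using hL 0
  have hLb : s • L (g 0) + r • p • L (g 2) = b := by simpa [mul_smul] using hL 1
  have hLc : r • q • L (g 0) + s • L (g 1) = c := by simpa [mul_smul] using hL 2
  have hf : Orthonormal ℂ fun i => L (g i) := hg.comp_linearIsometry L
  have hm : ∀ i, L (g i) ∈ Submodule.span ℂ (Set.range fun i => L (g i)) := fun i =>
    Submodule.subset_span ⟨i, rfl⟩
  refine ⟨⟨_, hf⟩, ?_, ?_, ?_, ?_⟩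
  · rintro ψ (rfl | rfl | rfl)
    · rw [← hLa]
      exact add_mem (Submodule.smul_mem _ _ (Submodule.smul_mem _ _ (hm 1)))
        (Submodule.smul_mem _ _ (hm 2))
    · rw [← hLb]
      exact add_mem (Submodule.smul_mem _ _ (hm 0))
        (Submodule.smul_mem _ _ (Submodule.smul_mem _ _ (hm 2)))
    · rw [← hLc]
      exact add_mem (Submodule.smul_mem _ _ (Submodule.smul_mem _ _ (hm 0)))
        (Submodule.smul_mem _ _ (hm 1))
  · rw [← hLa]
    simp [hg']
  · rw [← hLb]
    simp [hg']
  · rw [← hLc]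
    simp [hg']

theorem exists_setup {d : ℕ} (hd : 4 ≤ d) (B : Fin (d + 1) → OrthonormalBasis (Fin d) ℂ (Hilb d))
    (hB : MutuallyUnbiased B) (i₀ : Fin d) : ∃ E : Setup d, E.B = B ∧ E.i₀ = i₀ := by
  have h4 : (4 : ℝ) ≤ d := by exact_mod_cast hd
  have h : ∀ α i β j : Fin d, ∃ f : OrthoTriple d, α < β →
      PPTriple f (basisState (B α.succ) i) (basisState (B β.succ) j) (basisState (B 0) i₀) := by
    intro α i β j
    by_cases hαβ : α < β
    · obtain ⟨f, hf⟩ := exists_ppTriple (by omega) (x := 1 / (d : ℝ)) (by positivity)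
        (one_div_le_one_div_of_le (by norm_num) h4)
        (basisState (B α.succ) i) (basisState (B β.succ) j) (basisState (B 0) i₀)
        (hB _ _ (fun h => hαβ.ne (Fin.succ_injective _ h)) _ _)
        (hB _ _ (Fin.succ_ne_zero β) _ _) (hB _ _ (Fin.succ_ne_zero α).symm _ _)
      exact ⟨f, fun _ => hf⟩
    -- An arbitrary triple, as `f` must be total.
    · exact ⟨(exists_orthoTriple (by omega)).some, fun h => absurd h hαβ⟩
  choose f hf using h
  exact ⟨⟨B, hB, i₀, f, hf⟩, rfl, rfl⟩

/-! ### Quadratic phases in every characteristic -/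

/-- The abelian extension of `G` by `A` defined by a symmetric bilinear cocycle. -/
@[ext]
structure BilinExt {G A : Type*} [AddCommGroup G] [AddCommGroup A] (c : G →+ G →+ A) where
  fst : G
  snd : A

namespace BilinExt

variable {G A : Type*} [AddCommGroup G] [AddCommGroup A] {c : G →+ G →+ A}

instance : Add (BilinExt c) := ⟨fun x y => ⟨x.fst + y.fst, x.snd + y.snd - c x.fst y.fst⟩⟩
instance : Zero (BilinExt c) := ⟨⟨0, 0⟩⟩
instance : Neg (BilinExt c) := ⟨fun x => ⟨-x.fst, -x.snd - c x.fst x.fst⟩⟩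

@[simp] theorem fst_add (x y : BilinExt c) : (x + y).fst = x.fst + y.fst := rfl
@[simp] theorem snd_add (x y : BilinExt c) : (x + y).snd = x.snd + y.snd - c x.fst y.fst := rfl
@[simp] theorem fst_zero : (0 : BilinExt c).fst = 0 := rfl
@[simp] theorem snd_zero : (0 : BilinExt c).snd = 0 := rfl
@[simp] theorem fst_neg (x : BilinExt c) : (-x).fst = -x.fst := rfl
@[simp] theorem snd_neg (x : BilinExt c) : (-x).snd = -x.snd - c x.fst x.fst := rfl

/-- The group structure, for a symmetric cocycle. -/
abbrev addCommGroup (hc : ∀ x y, c x y = c y x) : AddCommGroup (BilinExt c) where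
  add_assoc x y z := by
    ext
    · simp [add_assoc]
    · simp
      abel
  zero_add x := by ext <;> simp
  add_zero x := by ext <;> simp
  nsmul := nsmulRec
  zsmul := zsmulRec
  neg_add_cancel x := by
    ext
    · simp
    · simp
      abel
  add_comm x y := by
    ext
    · simp [add_comm]
    · simp [add_comm, hc x.fst y.fst]

end BilinExt

/-- Every symmetric bilinear map into a divisible group is the polarization of some function. -/
theorem exists_polarization {G A : Type*} [AddCommGroup G] [AddCommGroup A] [DivisibleBy A ℤ]
    (c : G →+ G →+ A) (hc : ∀ x y, c x y = c y x) :
    ∃ q : G → A, ∀ x y, q (x + y) = q x + q y + c x y := by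
  let := BilinExt.addCommGroup hc
  let s : A →+ BilinExt c :=
    { toFun := fun a => ⟨0, a⟩
      map_zero' := rfl
      map_add' := fun a b => by ext <;> simp }
  have hs : Function.Injective s := fun a b h => congrArg BilinExt.snd h
  -- Divisible groups are injective, so the subgroup `A` is a retract of the extension. On `x ↦ (x,
  -- 0)`, which fails to be additive by exactly the cocycle, the retraction is the required
  -- function.
  obtain ⟨r, hr⟩ := (Module.Baer.of_divisible A).extension_property_addMonoidHom s hs
    (AddMonoidHom.id A)
  have hr' : ∀ a, r ⟨0, a⟩ = a := fun a => DFunLike.congr_fun hr a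
  refine ⟨fun x => r ⟨x, 0⟩, fun x y => ?_⟩
  calc r ⟨x + y, 0⟩ = r (⟨x, 0⟩ + ⟨y, 0⟩ + ⟨0, c x y⟩) := by
        congr 1
        ext <;> simp
    _ = _ := by rw [map_add, map_add, hr']

instance : DivisibleBy (Additive Circle) ℤ :=
  divisibleByOfSMulRightSurj _ _ fun {n} hn z => by
    refine ⟨Additive.ofMul (Circle.exp (Complex.arg z.toMul / n)), ?_⟩
    apply Additive.toMul.injective
    change Circle.exp (Complex.arg z.toMul / n) ^ n = z.toMul
    rw [← Circle.exp_zsmul, zsmul_eq_mul, mul_div_cancel₀ _ (Int.cast_ne_zero.2 hn), Circle.exp_arg]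

/-- Over a commutative ring every `ψ (a x y)` is the polarization of a circle-valued function. -/
theorem exists_quadratic_phase {F : Type*} [CommRing F] (ψ : AddChar F Circle) (a : F) :
    ∃ θ : F → Circle, ∀ x y, θ (x + y) = θ x * θ y * ψ (a * x * y) := by
  obtain ⟨q, hq⟩ := exists_polarization (A := Additive Circle)
    (AddMonoidHom.mk' (fun x : F => AddMonoidHom.mk'
      (fun y : F => Additive.ofMul (ψ (a * x * y))) fun y z => by
        rw [mul_add, AddChar.map_add_eq_mul, ofMul_mul]) fun x y => by
        ext z
        simp [mul_add, add_mul, AddChar.map_add_eq_mul])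
    (fun x y => by simp [mul_right_comm])
  exact ⟨fun x => (q x).toMul, fun x y => congrArg Additive.toMul (hq x y)⟩

/-! ### Character sums and mutually unbiased bases -/

theorem exists_isPrimitive_circle (F : Type*) [Field F] [Finite F] :
    ∃ ψ : AddChar F Circle, ψ.IsPrimitive := by
  refine ⟨AddChar.circleEquivComplex.symm (AddChar.FiniteField.primitiveChar_to_Complex F), ?_⟩
  refine AddChar.IsPrimitive.of_ne_one fun h => ?_
  have h1 : AddChar.FiniteField.primitiveChar_to_Complex F = 0 := by
    rw [← map_eq_zero_iff _ AddChar.circleEquivComplex.symm.injective]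
    exact h
  refine AddChar.FiniteField.primitiveChar_to_Complex_isPrimitive F one_ne_zero ?_
  rw [h1]
  ext x
  simp

theorem sum_circle_mulShift {F : Type*} [Field F] [Fintype F] [DecidableEq F]
    {ψ : AddChar F Circle} (hψ : ψ.IsPrimitive) (b : F) :
    ∑ x, (ψ (x * b) : ℂ) = if b = 0 then (Fintype.card F : ℂ) else 0 := by
  have h := AddChar.sum_mulShift b
    (hψ.compMulHom_of_isPrimitive (f := Circle.coeHom) Circle.coe_injective)
  push_cast at h
  exact h

/-- Gauss sums of nondegenerate quadratic phases have absolute value `√|F|`. -/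
theorem norm_sq_sum_quadratic_phase {F : Type*} [Field F] [Fintype F] {ψ : AddChar F Circle}
    (hψ : ψ.IsPrimitive) {a : F} (ha : a ≠ 0) {u : F → Circle}
    (hu : ∀ x y, u (x + y) = u x * u y * ψ (a * x * y)) :
    ‖∑ x, (u x : ℂ)‖ ^ 2 = Fintype.card F := by
  classical
  have hu0 : u 0 = 1 := by simpa using hu 0 0
  have hc : ∀ y, (starRingEnd ℂ) (u y : ℂ) * u y = 1 := fun y => by
    rw [Complex.conj_mul', Circle.norm_coe]
    simp
  have key : (starRingEnd ℂ) (∑ y, (u y : ℂ)) * ∑ x, (u x : ℂ) = Fintype.card F := by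
    calc (starRingEnd ℂ) (∑ y, (u y : ℂ)) * ∑ x, (u x : ℂ)
        = ∑ y, ∑ x, (starRingEnd ℂ) (u y : ℂ) * u (x + y) := by
          rw [map_sum, Finset.sum_mul]
          refine Finset.sum_congr rfl fun y _ => ?_
          rw [← Finset.mul_sum]
          congr 1
          exact (Fintype.sum_equiv (Equiv.addRight y) _ _ fun x => rfl).symm
      _ = ∑ x, ∑ y, (u x : ℂ) * ψ (y * (a * x)) := by
          rw [Finset.sum_comm]
          refine Finset.sum_congr rfl fun x _ => Finset.sum_congr rfl fun y _ => ?_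
          rw [hu, mul_comm (a * x) y, Circle.coe_mul, Circle.coe_mul]
          linear_combination (u x : ℂ) * ψ (y * (a * x)) * hc y
      -- Summing over `y` first leaves only `x = 0`, since `a ≠ 0`.
      _ = _ := by
          simp_rw [← Finset.mul_sum, sum_circle_mulShift hψ]
          simp [ha, hu0]
  rw [Complex.conj_mul'] at key
  exact_mod_cast key

/-- Over a field with `d` elements, `d` orthonormal bases of quadratic phases and the standard
basis are mutually unbiased. -/
theorem exists_mutuallyUnbiased_of_field {d : ℕ} {F : Type*} [Field F] [Fintype F]
    (e : Fin d ≃ F) :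
    ∃ B : Fin (d + 1) → OrthonormalBasis (Fin d) ℂ (Hilb d), MutuallyUnbiased B := by
  classical
  obtain ⟨ψ, hψ⟩ := exists_isPrimitive_circle F
  choose θ hθ using exists_quadratic_phase ψ
  have hcard : Fintype.card F = d := by rw [← Fintype.card_congr e, Fintype.card_fin]
  have hd : 0 < (d : ℝ) := by
    rw [← hcard]
    exact_mod_cast Fintype.card_pos
  have hdC : (d : ℂ) ≠ 0 := by exact_mod_cast hd.ne'
  let v : F → Fin d → Hilb d := fun a i =>
    WithLp.toLp 2 fun k => (Real.sqrt d : ℂ)⁻¹ * (θ a (e k) * ψ (e i * e k) : Circle)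
  let u : F → Fin d → F → Fin d → F → Circle := fun a i b j x =>
    (θ a x)⁻¹ * θ b x * ψ ((e j - e i) * x)
  have hsq : (Real.sqrt d : ℂ)⁻¹ * (Real.sqrt d : ℂ)⁻¹ = (d : ℂ)⁻¹ := by
    rw [← mul_inv, ← Complex.ofReal_mul, Real.mul_self_sqrt hd.le]
    simp
  have hin : ∀ a i b j, ⟪v a i, v b j⟫_ℂ = (d : ℂ)⁻¹ * ∑ x, (u a i b j x : ℂ) := by
    intro a i b j
    rw [← e.sum_comp, Finset.mul_sum, PiLp.inner_apply]
    refine Finset.sum_congr rfl fun k _ => ?_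
    have h1 : u a i b j (e k) = (θ a (e k) * ψ (e i * e k))⁻¹ * (θ b (e k) * ψ (e j * e k)) := by
      ext
      simp only [u, sub_mul, AddChar.map_sub_eq_div, Circle.coe_mul, Circle.coe_inv, Circle.coe_div]
      ring
    rw [h1, Circle.coe_mul, Circle.coe_inv_eq_conj, ← hsq]
    simp only [v, RCLike.inner_apply, map_mul, map_inv₀, Complex.conj_ofReal]
    ring
  -- Within one basis the quadratic phases cancel and a plain character sum remains.
  have hon : ∀ a, Orthonormal ℂ (v a) := by
    intro a
    rw [orthonormal_iff_ite]
    intro i j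
    have h1 : ∀ x, (u a i a j x : ℂ) = ψ (x * (e j - e i)) := fun x => by
      simp [u, mul_comm]
    rw [hin, Finset.sum_congr rfl fun x _ => h1 x, sum_circle_mulShift hψ, hcard]
    by_cases hij : i = j
    · simp [hij, hdC]
    · simp [hij, sub_eq_zero, Ne.symm hij]
  have hrank : Fintype.card (Fin d) = Module.finrank ℂ (Hilb d) := by simp
  have : Nonempty (Fin d) := ⟨e.symm 0⟩
  let b : F → OrthonormalBasis (Fin d) ℂ (Hilb d) := fun a =>
    (basisOfOrthonormalOfCardEqFinrank (hon a) hrank).toOrthonormalBasis (by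
      rw [coe_basisOfOrthonormalOfCardEqFinrank]
      exact hon a)
  have hb : ∀ a i, b a i = v a i := fun a i => by simp [b]
  have hbb : ∀ a a', a ≠ a' → ∀ i j, ‖⟪b a i, b a' j⟫_ℂ‖ ^ 2 = 1 / (d : ℝ) := by
    intro a a' haa' i j
    -- The quotient of two quadratic phases times a character is again a quadratic phase, with
    -- nonzero parameter `a' - a`.
    have h := norm_sq_sum_quadratic_phase hψ (sub_ne_zero.2 haa'.symm) (u := u a i a' j)
      fun x y => by
        ext
        simp only [u, hθ, mul_add, sub_mul, AddChar.map_add_eq_mul, AddChar.map_sub_eq_div,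
          Circle.coe_mul, Circle.coe_inv, Circle.coe_div]
        ring
    rw [hb, hb, hin, norm_mul, mul_pow, h, hcard, norm_inv, Complex.norm_natCast]
    field_simp
  let b₀ := EuclideanSpace.basisFun (Fin d) ℂ
  have h0 : ∀ a i j, ‖⟪b₀ i, b a j⟫_ℂ‖ ^ 2 = 1 / (d : ℝ) := by
    intro a i j
    have h1 : ⟪b₀ i, b a j⟫_ℂ = (Real.sqrt d : ℂ)⁻¹ * (θ a (e i) * ψ (e j * e i) : Circle) := by
      rw [hb, EuclideanSpace.basisFun_inner]
    rw [h1, norm_mul, Circle.norm_coe, mul_one, norm_inv, Complex.norm_real, inv_pow,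
      Real.norm_of_nonneg (Real.sqrt_nonneg _), Real.sq_sqrt hd.le, one_div]
  refine ⟨Fin.cons b₀ fun α => b (e α), fun α β hαβ i j => ?_⟩
  induction α using Fin.cases with
  | zero =>
    induction β using Fin.cases with
    | zero => exact absurd rfl hαβ
    | succ β => exact h0 _ _ _
  | succ α =>
    induction β using Fin.cases with
    | zero =>
      rw [norm_inner_symm]
      exact h0 _ _ _
    | succ β => exact hbb _ _ (fun h => hαβ (congrArg Fin.succ (e.injective h))) _ _

theorem exists_mutuallyUnbiased {d : ℕ} (hd : IsPrimePow d) :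
    ∃ B : Fin (d + 1) → OrthonormalBasis (Fin d) ℂ (Hilb d), MutuallyUnbiased B := by
  obtain ⟨p, n, hp, hn, rfl⟩ := (isPrimePow_nat_iff d).1 hd
  have : Fact p.Prime := ⟨hp⟩
  have : Fintype (GaloisField p n) := Fintype.ofFinite _
  refine exists_mutuallyUnbiased_of_field (F := GaloisField p n) (Fintype.equivFinOfCardEq ?_).symm
  rw [Fintype.card_eq_nat_card, GaloisField.card p n hn.ne']

end OntModel

end

theorem mainTheorem4 (d : ℕ) (hd : 4 ≤ d) (hpp : IsPrimePow d) :
    -- there are `d + 1` mutually unbiased bases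
    (∃ B : Fin (d + 1) → OrthonormalBasis (Fin d) ℂ (OntModel.Hilb d),
      OntModel.MutuallyUnbiased B) ∧
    -- for all such bases and every element of the basis `0`, the measurements can be chosen
    (∀ B : Fin (d + 1) → OrthonormalBasis (Fin d) ℂ (OntModel.Hilb d),
      OntModel.MutuallyUnbiased B → ∀ i₀ : Fin d, ∃ E : OntModel.Setup d, E.B = B ∧ E.i₀ = i₀) ∧
    -- the threshold on the average noise is positive
    0 < 2 / ((d : ℝ) - 1) * (1 - Real.sqrt (1 - 1 / (d : ℝ)) - 1 / (d : ℝ) ^ 2) ∧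
    -- the bounds
    ∀ (E : OntModel.Setup d) (R : OntModel.Frequencies d)
      (Λ : Type*) [MeasurableSpace Λ] (ν : MeasureTheory.Measure Λ)
      (m : OntModel.OntologicalModel d Λ ν) (k : ℝ),
      OntModel.Predicts m E R → OntModel.NoFourthOutcome E R →
      (∀ ψ φ : OntModel.PureState d,
        k * OntModel.omegaQ ψ φ ≤ OntModel.omegaC ν (m.μ ψ) (m.μ φ)) →
      k * (d : ℝ) ^ 2 * (1 - Real.sqrt (1 - 1 / (d : ℝ))) ≤
          1 + 3 * OntModel.sumTriple E R + 2 * OntModel.sumPair E R ∧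
        k < 2 / (d : ℝ) +
          (d : ℝ) ^ 2 * (3 * (d : ℝ) * OntModel.eps1 E R + 2 * OntModel.eps2 E R) ∧
        (3 * (d : ℝ) * OntModel.eps1 E R + 2 * OntModel.eps2 E R <
            2 / ((d : ℝ) - 1) * (1 - Real.sqrt (1 - 1 / (d : ℝ)) - 1 / (d : ℝ) ^ 2) →
          k < 1) := by
  have h4 : (4 : ℝ) ≤ d := by exact_mod_cast hd
  have : NeZero d := ⟨by omega⟩
  refine ⟨OntModel.exists_mutuallyUnbiased hpp, OntModel.exists_setup hd,
    OntModel.noise_threshold_pos h4, ?_⟩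
  intro E R Λ _ ν m k hP hN hk
  have h := OntModel.mul_le_of_omegaQ_le hP hN hk
  have heq := OntModel.noise_eq_eps (by omega) E R
  have hnoise : 0 ≤ 3 * (d : ℝ) * OntModel.eps1 E R + 2 * OntModel.eps2 E R := by
    have hT := OntModel.sumTriple_nonneg hP
    have hS := OntModel.sumPair_nonneg hP
    have h1 : 0 ≤ (d : ℝ) - 1 := by linarith
    unfold OntModel.eps1 OntModel.eps2
    positivity
  refine ⟨h, ?_⟩
  rw [add_assoc, heq] at h
  exact ⟨OntModel.lt_of_mul_le h4 hnoise h, OntModel.lt_one_of_mul_le h4 h⟩
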